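/- **Setting.** Let $\Delta=(v_1,\dots,v_n)$ be a family of nonzero vectors in $\mathbb Z^2$, $F\subseteq\{1,\dots,n\}$ and $r,s\ge 0$. A connected *$(r,s)$-marked curve of degree $\Delta$* is a map $h:\Gamma\to\mathbb R^2$ from a metric tree $\Gamma$ (all vertices of valence at least $3$) with $r$ real markings and $s$ complex markings (labeled unbounded edges contracted by $h$) and $n$ further labeled unbounded edges, the *ends* $y_1,\dots,y_n$, such that $h$ is integer affine linear on every edge, the outward direction vector of $y_i$ is $v_i$, and at every vertex the outgoing direction vectors sum to $0$. The *weight* of an edge is the gcd of the entries of its direction vector; write $w_i$ for the weight of $y_i$. An edge is *even* or *odd* according to the parity of its weight. An *oriented* curve with set of fixed ends $F$ carries in addition an orientation of every unmarked edge, such that the end $y_i$ is oriented inwards if and only if $i\in F$ (ends with $i\notin F$ are called *non-fixed*). The *Mikhalkin multiplicity* $a_V\ge 0$ of a vertex $V$ with exactly three unmarked edges is the absolute value of the determinant of the direction vectors of any two of them. An oriented curve $C$ with set of fixed ends $F$ is an *oriented refined broccoli curve* if each of its vertices is of one of the following types (edges of any parity): * (I) one real marking, two unmarked edges, both outgoing;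 $m_V=1$; * (II) no marking, three unmarked edges, two ingoing and one outgoing; $m_V=\dfrac{y^{a_V/2}-y^{-a_V/2}}{y^{1/2}-y^{-1/2}}$; * (III) one complex marking, three unmarked edges, all outgoing; $m_V=\dfrac{y^{a_V/2}+y^{-a_V/2}}{y^{1/2}+y^{-1/2}}$. Its refined multiplicity is the rational function in $y^{1/2}$ $$m_C(y)=\prod_{i\in F}\frac{y^{w_i/2}+(-1)^{w_i}y^{-w_i/2}}{y^{1/2}+(-1)^{w_i}y^{-1/2}}\ \prod_{i\notin F}\frac{y^{w_i/2}-(-1)^{w_i}y^{-w_i/2}}{w_i\,(y^{1/2}-(-1)^{w_i}y^{-1/2})}\ \prod_{V}m_V .$$ Its broccoli index is $$i_B(C)=-\#\{V\text{ of type (III)}: a_V \text{ even}\}-\#\{i\in F: w_i\text{ even}\}+\#\{V\text{ of type (II)}: a_V\text{ even}\}+\#\{i\notin F: w_i\text{ even}\}.$$ $C$ is an *old broccoli curve* if each of its vertices is of one of the types: (1) type (I) with odd edges; (2) type (II) with three odd edges; (3) type (II) with one ingoing even edge, one ingoing odd edge and an outgoing odd edge; (4) type (II) with three even edges; (5) type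 (III) with three odd edges; (6) type (III) with one even and two odd edges. Call $C$ *nondegenerate* if $a_V\neq 0$ for every vertex $V$ of type (II), i.e. if the three edges at such a vertex are not all parallel. **Lemma.** Let $C$ be an oriented refined broccoli curve with set of fixed ends $F$. (a) $m_C(y)$ is a Laurent polynomial in $y$ with rational coefficients, $m_C(y)\prod_{i\notin F}w_i\in\mathbb Z[y^{\pm1}]$, and $m_C(y)=m_C(y^{-1})$. In particular $m_C(y)\in\mathbb Z[y^{\pm1}]$ if all ends are fixed. (b) If $C$ is an old broccoli curve and is nondegenerate, then $m_C(-1)\neq0$. (c) If $C$ is not an old broccoli curve, then $m_C(-1)=0$; moreover $i_B(C)$ is even and strictly positive, and $m_C(y)=(y^{1/2}+y^{-1/2})^{i_B(C)}f(y)$ for some $f\in\mathbb Q[y^{\pm1}]$, where $f(-1)\neq0$ if $C$ is nondegenerate. -/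

import Mathlib

open scoped LaurentPolynomial

/-- The weight of an edge with direction vector `u`: the gcd of its entries. -/
def latticeWeight (u : ℤ × ℤ) : ℕ := Int.gcd u.1 u.2

/-- A connected `(r, s)`-marked plane rational parametrized tropical curve of degree `Δ`.

The abstract graph `Γ` has vertices `V`, bounded edges the edges of the tree `graph` with positive
lengths, unbounded edges `y_i` attached at `endVertex i` (the ends), and unbounded edges attached
at `markVertex j` (the markings, contracted by `h`). Real markings are indexed by `Fin r`, complex
markings by `Fin s`. The map `h : Γ → ℝ²` is given by the images `pos` of the vertices and the
integer direction vectors `dartDir d` (pointing from `d.fst` to `d.snd`) and `Δ i` (pointing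
outwards); it is integer affine linear on edges and balanced at every vertex. -/
structure MarkedCurve (r s : ℕ) {n : ℕ} (Δ : Fin n → ℤ × ℤ) where
  V : Type
  [fintypeV : Fintype V]
  [decEqV : DecidableEq V]
  graph : SimpleGraph V
  [decAdj : DecidableRel graph.Adj]
  isTree : graph.IsTree
  length : graph.edgeSet → ℝ
  length_pos : ∀ e, 0 < length e
  endVertex : Fin n → V
  markVertex : Fin r ⊕ Fin s → V
  three_le_valence : ∀ v, 3 ≤ graph.degree v
    + (Finset.univ.filter fun i => endVertex i = v).card
    + (Finset.univ.filter fun j => markVertex j = v).card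
  pos : V → ℝ × ℝ
  dartDir : graph.Dart → ℤ × ℤ
  dartDir_symm : ∀ d, dartDir d.symm = -dartDir d
  pos_snd : ∀ d : graph.Dart, pos d.snd = pos d.fst +
    length ⟨d.edge, d.edge_mem⟩ • (((dartDir d).1 : ℝ), ((dartDir d).2 : ℝ))
  end_ne_zero : ∀ i, Δ i ≠ 0
  balanced : ∀ v, (∑ d ∈ Finset.univ.filter fun d : graph.Dart => d.fst = v, dartDir d)
    + (∑ i ∈ Finset.univ.filter fun i => endVertex i = v, Δ i) = 0

attribute [instance] MarkedCurve.fintypeV MarkedCurve.decEqV MarkedCurve.decAdj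

/-- An oriented `(r, s)`-marked curve of degree `Δ` with set of fixed ends `F`: every unmarked edge
carries an orientation, and the fixed ends are exactly the ends that are oriented inwards.
`forward d = true` means that the bounded edge of the dart `d` is oriented from `d.fst` to
`d.snd`. -/
structure OrientedCurve (r s : ℕ) {n : ℕ} (Δ : Fin n → ℤ × ℤ) (F : Finset (Fin n)) extends
    MarkedCurve r s Δ where
  forward : graph.Dart → Bool
  forward_symm : ∀ d, forward d.symm = !forward d

/-- The type of a vertex: the numbers of real and complex markings adjacent to it, and the numbers
of adjacent unmarked edges of each parity and orientation (`In`: towards the vertex). -/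
structure VertexType where
  real : ℕ
  complex : ℕ
  oddIn : ℕ
  oddOut : ℕ
  evenIn : ℕ
  evenOut : ℕ

namespace VertexType

/-- Vertex type (1): a real marking on an odd edge, both halves outgoing. -/
def t1 : VertexType :=
  { real := 1, complex := 0, oddIn := 0, oddOut := 2, evenIn := 0, evenOut := 0 }

/-- Vertex type (2): unmarked, two odd edges ingoing and one odd edge outgoing. -/
def t2 : VertexType :=
  { real := 0, complex := 0, oddIn := 2, oddOut := 1, evenIn := 0, evenOut := 0 }

/-- Vertex type (3): unmarked, one even and one odd edge ingoing, one odd edge outgoing. -/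
def t3 : VertexType :=
  { real := 0, complex := 0, oddIn := 1, oddOut := 1, evenIn := 1, evenOut := 0 }

/-- Vertex type (4): unmarked, two even edges ingoing and one even edge outgoing. -/
def t4 : VertexType :=
  { real := 0, complex := 0, oddIn := 0, oddOut := 0, evenIn := 2, evenOut := 1 }

/-- Vertex type (5): a complex marking and three outgoing odd edges. -/
def t5 : VertexType :=
  { real := 0, complex := 1, oddIn := 0, oddOut := 3, evenIn := 0, evenOut := 0 }

/-- Vertex type (6): a complex marking, two outgoing odd edges (parallel in type (6b), not parallel
in type (6a)) and one outgoing even edge. -/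
def t6 : VertexType :=
  { real := 0, complex := 1, oddIn := 0, oddOut := 2, evenIn := 0, evenOut := 1 }

/-- The vertex types allowed in a broccoli curve. -/
def IsOldBroccoli (τ : VertexType) : Prop :=
  τ = t1 ∨ τ = t2 ∨ τ = t3 ∨ τ = t4 ∨ τ = t5 ∨ τ = t6

/-- Vertex type (I): a real marking and two outgoing edges of any parity. -/
def IsI (τ : VertexType) : Prop :=
  τ.real = 1 ∧ τ.complex = 0 ∧ τ.oddIn + τ.evenIn = 0 ∧ τ.oddOut + τ.evenOut = 2

/-- Vertex type (II): no marking, two ingoing edges and one outgoing edge of any parity. -/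
def IsII (τ : VertexType) : Prop :=
  τ.real = 0 ∧ τ.complex = 0 ∧ τ.oddIn + τ.evenIn = 2 ∧ τ.oddOut + τ.evenOut = 1

/-- Vertex type (III): a complex marking and three outgoing edges of any parity. -/
def IsIII (τ : VertexType) : Prop :=
  τ.real = 0 ∧ τ.complex = 1 ∧ τ.oddIn + τ.evenIn = 0 ∧ τ.oddOut + τ.evenOut = 3

end VertexType

namespace OrientedCurve

variable {r s n : ℕ} {Δ : Fin n → ℤ × ℤ} {F : Finset (Fin n)}

/-- The flags of unmarked edges: a dart `d` is the half of its bounded edge at `d.fst`, and `i` is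
the end `y_i`. -/
abbrev Flag (C : OrientedCurve r s Δ F) : Type := C.graph.Dart ⊕ Fin n

/-- The vertex of a flag. -/
def base (C : OrientedCurve r s Δ F) : C.Flag → C.V
  | .inl d => d.fst
  | .inr i => C.endVertex i

/-- The direction vector of a flag, pointing away from its vertex. -/
def dir (C : OrientedCurve r s Δ F) : C.Flag → ℤ × ℤ
  | .inl d => C.dartDir d
  | .inr i => Δ i

/-- Whether the edge of a flag is oriented away from the vertex of the flag. -/
def out (C : OrientedCurve r s Δ F) : C.Flag → Bool
  | .inl d => C.forward d
  | .inr i => decide (i ∉ F)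

/-- Whether the edge of a flag is even, that is, has even weight. -/
def evenFlag (C : OrientedCurve r s Δ F) (f : C.Flag) : Bool :=
  decide (Even (latticeWeight (C.dir f)))

/-- The flags at the vertex `v`. -/
def flagsAt (C : OrientedCurve r s Δ F) (v : C.V) : Finset C.Flag :=
  Finset.univ.filter fun f => C.base f = v

/-- The number of unmarked edges at `v` with given parity and orientation. -/
def flagCount (C : OrientedCurve r s Δ F) (v : C.V) (even out : Bool) : ℕ :=
  ((C.flagsAt v).filter fun f => C.evenFlag f = even ∧ C.out f = out).card

/-- The type of the vertex `v` of `C`. -/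
def vertexType (C : OrientedCurve r s Δ F) (v : C.V) : VertexType where
  real := (Finset.univ.filter fun j : Fin r => C.markVertex (.inl j) = v).card
  complex := (Finset.univ.filter fun j : Fin s => C.markVertex (.inr j) = v).card
  oddIn := C.flagCount v false false
  oddOut := C.flagCount v false true
  evenIn := C.flagCount v true false
  evenOut := C.flagCount v true true

/-- The Mikhalkin multiplicity of a vertex with three unmarked edges: the absolute value of the
determinant of the direction vectors of any two different ones of them. By the balancing condition
all pairs give the same value, which is taken here as a maximum over all pairs. -/
def mikhalkinMult (C : OrientedCurve r s Δ F) (v : C.V) : ℕ :=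
  (C.flagsAt v ×ˢ C.flagsAt v).sup fun p =>
    ((C.dir p.1).1 * (C.dir p.2).2 - (C.dir p.1).2 * (C.dir p.2).1).natAbs

theorem sum_dir_flagsAt (C : OrientedCurve r s Δ F) (v : C.V) :
    ∑ f ∈ C.flagsAt v, C.dir f = 0 := by
  rw [← C.balanced v, flagsAt, Finset.sum_filter, Fintype.sum_sum_type, Finset.sum_filter,
    Finset.sum_filter]
  rfl

/-- At a vertex with three unmarked edges every pair of different edges computes the Mikhalkin
multiplicity. -/
theorem mikhalkinMult_eq (C : OrientedCurve r s Δ F) (v : C.V) (h3 : (C.flagsAt v).card = 3)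
    (f g : C.Flag) (hf : f ∈ C.flagsAt v) (hg : g ∈ C.flagsAt v) (hfg : f ≠ g) :
    C.mikhalkinMult v =
      ((C.dir f).1 * (C.dir g).2 - (C.dir f).2 * (C.dir g).1).natAbs := by
  have hsub : ({f, g} : Finset C.Flag) ⊆ C.flagsAt v := by
    intro x hx
    rcases Finset.mem_insert.1 hx with rfl | hx
    · exact hf
    · rw [Finset.mem_singleton.1 hx]; exact hg
  have hc : (C.flagsAt v \ {f, g}).card = 1 := by
    rw [Finset.card_sdiff_of_subset hsub, h3, Finset.card_pair hfg]
  obtain ⟨k, hk⟩ := Finset.card_eq_one.1 hc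
  have hset : C.flagsAt v = {f, g} ∪ {k} := by
    rw [← hk, Finset.union_sdiff_of_subset hsub]
  have hkm : k ∉ ({f, g} : Finset C.Flag) := by
    have : k ∈ C.flagsAt v \ {f, g} := by rw [hk]; exact Finset.mem_singleton_self k
    exact (Finset.mem_sdiff.1 this).2
  have hs := C.sum_dir_flagsAt v
  rw [hset, Finset.sum_union (Finset.disjoint_singleton_right.2 hkm), Finset.sum_pair hfg,
    Finset.sum_singleton] at hs
  have h1 : (C.dir k).1 = -(C.dir f).1 - (C.dir g).1 := by
    have := congrArg Prod.fst hs
    simp only [Prod.fst_add, Prod.fst_zero] at this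
    linarith
  have h2 : (C.dir k).2 = -(C.dir f).2 - (C.dir g).2 := by
    have := congrArg Prod.snd hs
    simp only [Prod.snd_add, Prod.snd_zero] at this
    linarith
  apply le_antisymm
  · refine Finset.sup_le fun p hp => ?_
    rw [hset, Finset.mem_product] at hp
    obtain ⟨hp1, hp2⟩ := hp
    simp only [Finset.mem_union, Finset.mem_insert, Finset.mem_singleton] at hp1 hp2
    rcases hp1 with (hp1 | hp1) | hp1 <;> rcases hp2 with (hp2 | hp2) | hp2 <;>
      rw [hp1, hp2] <;> (try rw [h1, h2]) <;> ring_nf <;> omega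
  · exact Finset.le_sup (f := fun p : C.Flag × C.Flag =>
      ((C.dir p.1).1 * (C.dir p.2).2 - (C.dir p.1).2 * (C.dir p.2).1).natAbs)
      (Finset.mk_mem_product hf hg)

/-- `C` is an oriented refined broccoli curve: all its vertices are of type (I), (II) or (III). -/
def IsRefinedBroccoli (C : OrientedCurve r s Δ F) : Prop :=
  ∀ v, (C.vertexType v).IsI ∨ (C.vertexType v).IsII ∨ (C.vertexType v).IsIII

/-- `C` is an old broccoli curve: all its vertices are of type (1), (2), (3), (4), (5) or (6). -/
def IsOldBroccoli (C : OrientedCurve r s Δ F) : Prop :=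
  ∀ v, (C.vertexType v).IsOldBroccoli

/-- No vertex of type (II) has Mikhalkin multiplicity zero, that is, the three edges at an unmarked
vertex are not all parallel. -/
def IsNondegenerate (C : OrientedCurve r s Δ F) : Prop :=
  ∀ v, (C.vertexType v).IsII → C.mikhalkinMult v ≠ 0

open Classical in
/-- The broccoli index. Vertices of type (III) are those with a complex marking, vertices of type
(II) are those without; a point of type (I) lies in the interior of an edge of the image curve, is
no vertex of it, and does not enter. -/
noncomputable def broccoliIndex (C : OrientedCurve r s Δ F) : ℤ :=
  - ((Finset.univ.filter fun v => (C.vertexType v).IsIII ∧ Even (C.mikhalkinMult v)).card : ℤ)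
  - ((F.filter fun i => Even (latticeWeight (Δ i))).card : ℤ)
  + ((Finset.univ.filter fun v => (C.vertexType v).IsII ∧ Even (C.mikhalkinMult v)).card : ℤ)
  + ((Fᶜ.filter fun i => Even (latticeWeight (Δ i))).card : ℤ)

end OrientedCurve

/-- The variable `y^{1/2}`: refined multiplicities are rational functions in it. -/
noncomputable def sqrtY : RatFunc ℚ := RatFunc.X

theorem sqrtY_ne_zero : sqrtY ≠ 0 := RatFunc.X_ne_zero

/-- The Laurent polynomial `p(y)` in `y = (y^{1/2})^2`, as a rational function in `y^{1/2}`. -/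
noncomputable def laurentInY (R : Type) [CommRing R] [Algebra R (RatFunc ℚ)] :
    R[T;T⁻¹] →+* RatFunc ℚ :=
  LaurentPolynomial.eval₂ (algebraMap R (RatFunc ℚ)) (Units.mk0 (sqrtY ^ 2)
    (pow_ne_zero 2 sqrtY_ne_zero))

/-- The value `p(-1)`. -/
noncomputable def atNegOne (p : ℚ[T;T⁻¹]) : ℚ :=
  LaurentPolynomial.eval₂ (RingHom.id ℚ) (-1 : ℚˣ) p

namespace OrientedCurve

variable {r s n : ℕ} {Δ : Fin n → ℤ × ℤ} {F : Finset (Fin n)}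

open Classical in
/-- The refined multiplicity of a vertex of type (I), (II) or (III) (the last case is type (I)). -/
noncomputable def vertexMult (C : OrientedCurve r s Δ F) (v : C.V) : RatFunc ℚ :=
  if (C.vertexType v).IsII then
    (sqrtY ^ C.mikhalkinMult v - sqrtY⁻¹ ^ C.mikhalkinMult v) / (sqrtY - sqrtY⁻¹)
  else if (C.vertexType v).IsIII then
    (sqrtY ^ C.mikhalkinMult v + sqrtY⁻¹ ^ C.mikhalkinMult v) / (sqrtY + sqrtY⁻¹)
  else 1

end OrientedCurve

/-- The refined multiplicity of a fixed end of weight `w`. -/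
noncomputable def fixedEndMult (w : ℕ) : RatFunc ℚ :=
  (sqrtY ^ w + (-1) ^ w * sqrtY⁻¹ ^ w) / (sqrtY + (-1) ^ w * sqrtY⁻¹)

/-- The refined multiplicity of a non-fixed end of weight `w`. -/
noncomputable def nonFixedEndMult (w : ℕ) : RatFunc ℚ :=
  (sqrtY ^ w - (-1) ^ w * sqrtY⁻¹ ^ w) / ((w : RatFunc ℚ) * (sqrtY - (-1) ^ w * sqrtY⁻¹))

/-- The refined multiplicity `m_C(y)`, as a rational function in `y^{1/2}`. -/
noncomputable def OrientedCurve.refinedMult {r s n : ℕ} {Δ : Fin n → ℤ × ℤ} {F : Finset (Fin n)}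
    (C : OrientedCurve r s Δ F) : RatFunc ℚ :=
  (∏ i : Fin n, if i ∈ F then fixedEndMult (latticeWeight (Δ i))
    else nonFixedEndMult (latticeWeight (Δ i))) * ∏ v : C.V, C.vertexMult v

/-! ### Laurent polynomials in `y` as rational functions in `y^{1/2}` -/

/-! Put `s = y^{1/2}`. Every factor of the multiplicity, cleared of the weights of non-fixed ends,
equals `(s + s⁻¹)^e * g(y)` with `e ∈ {-1, 0, 1}` and `g` a symmetric integral Laurent polynomial.
Here `e = 0` for odd weight or Mikhalkin multiplicity; for even ones the sign in the numerator
decides between `1` and `-1`. The value `g(-1)` is explicit and vanishes only at a type (II) vertex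
of multiplicity zero. Multiplying, the exponents add up to the broccoli index
(`hasSymmetricExpansion_refinedMult`).

It remains to compute the index. Count even edges over all flags, outgoing as `+1` and ingoing as
`-1`. A bounded edge cancels against itself, so only the ends survive, and they give exactly their
part of the index. Grouped by vertices, the same sum makes the index a sum of local terms. Balancing
modulo 2 leaves few parity patterns, and the local term is `0` for the old types and `2` otherwise
(`vertexIndex_add_evenOut_sub_evenIn`). Hence the index is `2k`, with `k` the number of forbidden
vertices, and the power of `s + s⁻¹` is `(y + 2 + y⁻¹)^k`: a symmetric Laurent polynomial in `y`
that vanishes at `-1` exactly when `k > 0`. -/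

theorem aeval_sqrtY_ne_zero {q : Polynomial ℚ} (hq : q ≠ 0) :
    Polynomial.aeval sqrtY q ≠ 0 := by
  have h : Polynomial.aeval sqrtY q = algebraMap (Polynomial ℚ) (RatFunc ℚ) q := by
    rw [sqrtY, ← RatFunc.algebraMap_X, Polynomial.aeval_algebraMap_apply, Polynomial.aeval_X_left,
      AlgHom.id_apply]
  rw [h]
  exact RatFunc.algebraMap_ne_zero hq

theorem sqrtY_add_inv_ne_zero : sqrtY + sqrtY⁻¹ ≠ 0 := by
  have h := aeval_sqrtY_ne_zero (q := Polynomial.X ^ 2 + Polynomial.C 1)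
    (Polynomial.X_pow_add_C_ne_zero two_pos 1)
  intro h0
  apply h
  have hx := sqrtY_ne_zero
  field_simp at h0
  simpa using h0

theorem sqrtY_sub_inv_ne_zero : sqrtY - sqrtY⁻¹ ≠ 0 := by
  have h := aeval_sqrtY_ne_zero (q := Polynomial.X ^ 2 - Polynomial.C 1)
    (Polynomial.X_pow_sub_C_ne_zero two_pos 1)
  intro h0
  apply h
  have hx := sqrtY_ne_zero
  field_simp at h0
  simpa using h0

theorem laurentInY_T {R : Type} [CommRing R] [Algebra R (RatFunc ℚ)] (n : ℤ) :
    laurentInY R (LaurentPolynomial.T n) = sqrtY ^ (2 * n) := by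
  rw [laurentInY, LaurentPolynomial.eval₂_T, Units.val_zpow_eq_zpow_val, Units.val_mk0, zpow_mul]
  norm_cast

theorem laurentInY_C {R : Type} [CommRing R] [Algebra R (RatFunc ℚ)] (a : R) :
    laurentInY R (LaurentPolynomial.C a) = algebraMap R (RatFunc ℚ) a := by
  rw [laurentInY, LaurentPolynomial.eval₂_C]

/-- Evaluation of an integral Laurent polynomial at `-1`. -/
noncomputable def intAtNegOne : ℤ[T;T⁻¹] →+* ℚ :=
  LaurentPolynomial.eval₂ (Int.castRingHom ℚ) (-1 : ℚˣ)

theorem intAtNegOne_T (n : ℤ) : intAtNegOne (LaurentPolynomial.T n) = (-1) ^ n := by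
  rw [intAtNegOne, LaurentPolynomial.eval₂_T, Units.val_zpow_eq_zpow_val]
  simp

/-- The inclusion of integral Laurent polynomials into rational ones. -/
noncomputable def laurentIntToRat : ℤ[T;T⁻¹] →+* ℚ[T;T⁻¹] :=
  AddMonoidAlgebra.mapRingHom ℤ (Int.castRingHom ℚ)

theorem laurentIntToRat_T (n : ℤ) :
    laurentIntToRat (LaurentPolynomial.T n) = LaurentPolynomial.T n := by
  rw [laurentIntToRat, LaurentPolynomial.T, AddMonoidAlgebra.mapRingHom_single, map_one]
  rfl

theorem laurentInY_laurentIntToRat (g : ℤ[T;T⁻¹]) :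
    laurentInY ℚ (laurentIntToRat g) = laurentInY ℤ g := by
  induction g using LaurentPolynomial.induction_on' with
  | add p q hp hq => simp only [map_add, hp, hq]
  | C_mul_T n a =>
    have ha : (LaurentPolynomial.C a : ℤ[T;T⁻¹]) = (a : ℤ[T;T⁻¹]) := eq_intCast _ a
    simp only [ha, map_mul, map_intCast, laurentIntToRat_T, laurentInY_T]

theorem atNegOne_laurentIntToRat (g : ℤ[T;T⁻¹]) :
    atNegOne (laurentIntToRat g) = intAtNegOne g := by
  induction g using LaurentPolynomial.induction_on' with
  | add p q hp hq =>
    simp only [map_add, ← hp, ← hq]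
    simp only [atNegOne, map_add]
  | C_mul_T n a =>
    have ha : (LaurentPolynomial.C a : ℤ[T;T⁻¹]) = (a : ℤ[T;T⁻¹]) := eq_intCast _ a
    simp only [ha, map_mul, map_intCast, laurentIntToRat_T, intAtNegOne_T, atNegOne,
      LaurentPolynomial.eval₂_T, Units.val_zpow_eq_zpow_val]
    simp

theorem invert_laurentIntToRat (g : ℤ[T;T⁻¹]) :
    LaurentPolynomial.invert (laurentIntToRat g) =
      laurentIntToRat (LaurentPolynomial.invert g) := by
  induction g using LaurentPolynomial.induction_on' with
  | add p q hp hq => simp only [map_add, hp, hq]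
  | C_mul_T n a =>
    have ha : (LaurentPolynomial.C a : ℤ[T;T⁻¹]) = (a : ℤ[T;T⁻¹]) := eq_intCast _ a
    simp only [ha, map_mul, map_intCast, laurentIntToRat_T, LaurentPolynomial.invert_T]

open LaurentPolynomial in
theorem laurentInY_T_add_T_neg (m : ℕ) :
    laurentInY ℤ (T (m : ℤ) + T (-(m : ℤ))) = sqrtY ^ (2 * m) + sqrtY⁻¹ ^ (2 * m) := by
  rw [map_add, laurentInY_T, laurentInY_T, inv_pow]
  have h : sqrtY ^ (2 * (m : ℤ)) = sqrtY ^ (2 * m) := by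
    exact_mod_cast zpow_natCast sqrtY (2 * m)
  rw [mul_neg, zpow_neg, h]

open LaurentPolynomial in
theorem invert_T_add_T_neg (m : ℤ) : invert (T m + T (-m) : ℤ[T;T⁻¹]) = T m + T (-m) := by
  rw [map_add, invert_T, invert_T, neg_neg, add_comm]

open LaurentPolynomial in
theorem intAtNegOne_T_add_T_neg (m : ℕ) :
    intAtNegOne (T (m : ℤ) + T (-(m : ℤ))) = 2 * (-1) ^ m := by
  rw [map_add, intAtNegOne_T, intAtNegOne_T, zpow_neg, zpow_natCast, ← inv_pow]
  norm_num
  ring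

/-! ### Quotients for odd and even exponents, with their values at `-1` -/

/-- The Laurent polynomial `(y^{(2m+1)/2} - y^{-(2m+1)/2}) / (y^{1/2} - y^{-1/2})`. -/
theorem exists_laurent_odd_sub (m : ℕ) : ∃ g : ℤ[T;T⁻¹],
    (sqrtY - sqrtY⁻¹) * laurentInY ℤ g = sqrtY ^ (2 * m + 1) - sqrtY⁻¹ ^ (2 * m + 1) ∧
      LaurentPolynomial.invert g = g ∧ intAtNegOne g = (-1) ^ m := by
  induction m with
  | zero => exact ⟨1, by simp⟩
  | succ m ih =>
    obtain ⟨g, h1, h2, h3⟩ := ih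
    -- Telescoping: `(s - s⁻¹)(s^(2m+2) + s^(-2m-2))` is the difference of the right-hand sides for
    -- `m + 1` and `m`.
    refine ⟨(.T ((m + 1 : ℕ) : ℤ) + .T (-((m + 1 : ℕ) : ℤ))) + g, ?_, ?_, ?_⟩
    · rw [map_add, mul_add, h1, laurentInY_T_add_T_neg]
      generalize hz : sqrtY⁻¹ = z
      have h : sqrtY * z = 1 := hz ▸ mul_inv_cancel₀ sqrtY_ne_zero
      linear_combination (z ^ (2 * m + 1) - sqrtY ^ (2 * m + 1)) * h
    · rw [map_add, h2, invert_T_add_T_neg]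
    · rw [map_add, h3, intAtNegOne_T_add_T_neg]
      ring

/-- The Laurent polynomial `(y^{(2m+1)/2} + y^{-(2m+1)/2}) / (y^{1/2} + y^{-1/2})`. -/
theorem exists_laurent_odd_add (m : ℕ) : ∃ g : ℤ[T;T⁻¹],
    (sqrtY + sqrtY⁻¹) * laurentInY ℤ g = sqrtY ^ (2 * m + 1) + sqrtY⁻¹ ^ (2 * m + 1) ∧
      LaurentPolynomial.invert g = g ∧ intAtNegOne g = (-1) ^ m * (2 * m + 1) := by
  induction m with
  | zero => exact ⟨1, by simp⟩
  | succ m ih =>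
    obtain ⟨g, h1, h2, h3⟩ := ih
    -- With plus signs the product is the sum of consecutive right-hand sides, so `g` is subtracted
    -- and the values at `-1` grow in absolute value.
    refine ⟨(.T ((m + 1 : ℕ) : ℤ) + .T (-((m + 1 : ℕ) : ℤ))) - g, ?_, ?_, ?_⟩
    · rw [map_sub, mul_sub, h1, laurentInY_T_add_T_neg]
      generalize hz : sqrtY⁻¹ = z
      have h : sqrtY * z = 1 := hz ▸ mul_inv_cancel₀ sqrtY_ne_zero
      linear_combination (sqrtY ^ (2 * m + 1) + z ^ (2 * m + 1)) * h
    · rw [map_sub, h2, invert_T_add_T_neg]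
    · rw [map_sub, h3, intAtNegOne_T_add_T_neg]
      push_cast
      ring

/-- The Laurent polynomial `(y^m - y^{-m}) / (y - y^{-1})`. -/
theorem exists_laurent_even_sub (m : ℕ) : ∃ g : ℤ[T;T⁻¹],
    (sqrtY - sqrtY⁻¹) * ((sqrtY + sqrtY⁻¹) * laurentInY ℤ g) =
        sqrtY ^ (2 * m) - sqrtY⁻¹ ^ (2 * m) ∧
      LaurentPolynomial.invert g = g ∧ intAtNegOne g = -((-1) ^ m * m) := by
  -- Multiplying `y^(m+1) + y^(-m-1)` by `y - y⁻¹` links the exponents `m` and `m + 2`.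
  induction m using Nat.twoStepInduction with
  | zero => exact ⟨0, by simp⟩
  | one => exact ⟨1, by simp; ring, by simp, by simp⟩
  | more m ih _ =>
    obtain ⟨g, h1, h2, h3⟩ := ih
    refine ⟨(.T ((m + 1 : ℕ) : ℤ) + .T (-((m + 1 : ℕ) : ℤ))) + g, ?_, ?_, ?_⟩
    · rw [map_add, mul_add, mul_add, h1, laurentInY_T_add_T_neg]
      generalize hz : sqrtY⁻¹ = z
      have h : sqrtY * z = 1 := hz ▸ mul_inv_cancel₀ sqrtY_ne_zero
      linear_combination (sqrtY * z + 1) * (z ^ (2 * m) - sqrtY ^ (2 * m)) * h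
    · rw [map_add, h2, invert_T_add_T_neg]
    · rw [map_add, h3, intAtNegOne_T_add_T_neg]
      push_cast
      ring

/-! ### Factors of the multiplicity as powers of `y^{1/2} + y^{-1/2}` times symmetric Laurent
polynomials -/

/-- `r` is the product of `(y^{1/2} + y^{-1/2})^e` with a symmetric integral Laurent polynomial in
`y`, which does not vanish at `-1` if `P` holds. -/
def HasSymmetricExpansion (r : RatFunc ℚ) (e : ℤ) (P : Prop) : Prop :=
  ∃ g : ℤ[T;T⁻¹], r = (sqrtY + sqrtY⁻¹) ^ e * laurentInY ℤ g ∧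
    LaurentPolynomial.invert g = g ∧ (P → intAtNegOne g ≠ 0)

namespace HasSymmetricExpansion

theorem one : HasSymmetricExpansion 1 0 True :=
  ⟨1, by simp⟩

theorem mono {r : RatFunc ℚ} {e : ℤ} {P Q : Prop} (h : HasSymmetricExpansion r e P)
    (hQ : Q → P) : HasSymmetricExpansion r e Q := by
  obtain ⟨g, h1, h2, h3⟩ := h
  exact ⟨g, h1, h2, fun q => h3 (hQ q)⟩

theorem mul {r₁ r₂ : RatFunc ℚ} {e₁ e₂ : ℤ} {P₁ P₂ : Prop}
    (h₁ : HasSymmetricExpansion r₁ e₁ P₁) (h₂ : HasSymmetricExpansion r₂ e₂ P₂) :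
    HasSymmetricExpansion (r₁ * r₂) (e₁ + e₂) (P₁ ∧ P₂) := by
  obtain ⟨g, h1, h2, h3⟩ := h₁
  obtain ⟨g', h1', h2', h3'⟩ := h₂
  refine ⟨g * g', ?_, ?_, fun hP => ?_⟩
  · rw [h1, h1', zpow_add₀ sqrtY_add_inv_ne_zero, map_mul]
    ring
  · rw [map_mul, h2, h2']
  · rw [map_mul]
    exact mul_ne_zero (h3 hP.1) (h3' hP.2)

theorem prod {ι : Type} (t : Finset ι) {r : ι → RatFunc ℚ} {e : ι → ℤ} {P : ι → Prop}
    (h : ∀ i ∈ t, HasSymmetricExpansion (r i) (e i) (P i)) :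
    HasSymmetricExpansion (∏ i ∈ t, r i) (∑ i ∈ t, e i) (∀ i ∈ t, P i) := by
  classical
  induction t using Finset.induction_on with
  | empty => simpa using one
  | insert a t ha ih =>
    rw [Finset.prod_insert ha, Finset.sum_insert ha]
    refine ((h a (Finset.mem_insert_self a t)).mul
      (ih fun i hi => h i (Finset.mem_insert_of_mem hi))).mono fun hP => ?_
    exact ⟨hP a (Finset.mem_insert_self a t), fun i hi => hP i (Finset.mem_insert_of_mem hi)⟩

theorem odd_sub {a : ℕ} (ha : ¬ Even a) :
    HasSymmetricExpansion ((sqrtY ^ a - sqrtY⁻¹ ^ a) / (sqrtY - sqrtY⁻¹)) 0 True := by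
  obtain ⟨m, rfl⟩ := Nat.not_even_iff_odd.1 ha
  obtain ⟨g, h1, h2, h3⟩ := exists_laurent_odd_sub m
  refine ⟨g, ?_, h2, fun _ => ?_⟩
  · rw [← h1, mul_div_cancel_left₀ _ sqrtY_sub_inv_ne_zero, zpow_zero, one_mul]
  · rw [h3]
    exact pow_ne_zero m (by norm_num)

theorem odd_add {a : ℕ} (ha : ¬ Even a) :
    HasSymmetricExpansion ((sqrtY ^ a + sqrtY⁻¹ ^ a) / (sqrtY + sqrtY⁻¹)) 0 True := by
  obtain ⟨m, rfl⟩ := Nat.not_even_iff_odd.1 ha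
  obtain ⟨g, h1, h2, h3⟩ := exists_laurent_odd_add m
  refine ⟨g, ?_, h2, fun _ => ?_⟩
  · rw [← h1, mul_div_cancel_left₀ _ sqrtY_add_inv_ne_zero, zpow_zero, one_mul]
  · rw [h3]
    exact mul_ne_zero (pow_ne_zero m (by norm_num)) (by positivity)

/-- The value at `-1` is `±a/2`, so `a = 0` is the only degenerate case; this is the source of the
nondegeneracy hypothesis. -/
theorem even_sub {a : ℕ} (ha : Even a) :
    HasSymmetricExpansion ((sqrtY ^ a - sqrtY⁻¹ ^ a) / (sqrtY - sqrtY⁻¹)) 1 (a ≠ 0) := by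
  obtain ⟨m, rfl⟩ := even_iff_exists_two_mul.1 ha
  obtain ⟨g, h1, h2, h3⟩ := exists_laurent_even_sub m
  refine ⟨g, ?_, h2, fun h0 => ?_⟩
  · rw [← h1, mul_div_cancel_left₀ _ sqrtY_sub_inv_ne_zero, zpow_one]
  · rw [h3]
    have hm : m ≠ 0 := fun h => h0 (by rw [h, mul_zero])
    exact neg_ne_zero.2 (mul_ne_zero (pow_ne_zero m (by norm_num)) (by exact_mod_cast hm))

/-- The numerator is already a Laurent polynomial in `y` with value `±2` at `-1`. The denominator
need not divide it, which is why negative exponents are admitted. -/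
theorem even_add {a : ℕ} (ha : Even a) :
    HasSymmetricExpansion ((sqrtY ^ a + sqrtY⁻¹ ^ a) / (sqrtY + sqrtY⁻¹)) (-1) True := by
  obtain ⟨m, rfl⟩ := even_iff_exists_two_mul.1 ha
  refine ⟨_, ?_, invert_T_add_T_neg m, fun _ => ?_⟩
  · rw [laurentInY_T_add_T_neg, zpow_neg_one, div_eq_inv_mul]
  · rw [intAtNegOne_T_add_T_neg]
    exact mul_ne_zero two_ne_zero (pow_ne_zero m (by norm_num))

theorem fixedEndMult (w : ℕ) :
    HasSymmetricExpansion (fixedEndMult w) (if Even w then -1 else 0) True := by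
  by_cases hw : Even w
  · simpa [hw, _root_.fixedEndMult, hw.neg_one_pow] using even_add hw
  · simpa [hw, _root_.fixedEndMult, (Nat.not_even_iff_odd.1 hw).neg_one_pow, ← sub_eq_add_neg]
      using odd_sub hw

theorem nonFixedEndMult {w : ℕ} (h0 : w ≠ 0) :
    HasSymmetricExpansion (nonFixedEndMult w * w) (if Even w then 1 else 0) True := by
  have hw0 : (w : RatFunc ℚ) ≠ 0 := Nat.cast_ne_zero.2 h0
  have h : _root_.nonFixedEndMult w * w =
      (sqrtY ^ w - (-1) ^ w * sqrtY⁻¹ ^ w) / (sqrtY - (-1) ^ w * sqrtY⁻¹) := by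
    rw [_root_.nonFixedEndMult, mul_comm (w : RatFunc ℚ), ← div_div, div_mul_cancel₀ _ hw0]
  rw [h]
  by_cases hw : Even w
  · simpa [hw, hw.neg_one_pow] using (even_sub hw).mono fun _ => h0
  · simpa [hw, (Nat.not_even_iff_odd.1 hw).neg_one_pow] using odd_add hw

end HasSymmetricExpansion

/-! ### Parities of edges at a vertex -/

theorem even_latticeWeight_iff (u : ℤ × ℤ) :
    Even (latticeWeight u) ↔ Even u.1 ∧ Even u.2 := by
  rw [latticeWeight, even_iff_two_dvd, even_iff_two_dvd, even_iff_two_dvd, ← Int.natCast_dvd_natCast,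
    Nat.cast_ofNat, Int.dvd_coe_gcd_iff]

theorem latticeWeight_neg (u : ℤ × ℤ) : latticeWeight (-u) = latticeWeight u := by
  simp [latticeWeight]

theorem latticeWeight_ne_zero {u : ℤ × ℤ} (hu : u ≠ 0) : latticeWeight u ≠ 0 := by
  intro h
  rw [latticeWeight, Int.gcd_eq_zero_iff] at h
  exact hu (Prod.ext h.1 h.2)

theorem VertexType.IsI.not_isII {τ : VertexType} (h : τ.IsI) : ¬ τ.IsII := by
  rintro ⟨h', -⟩
  have := h.1
  omega

theorem VertexType.IsI.not_isIII {τ : VertexType} (h : τ.IsI) : ¬ τ.IsIII := by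
  rintro ⟨h', -⟩
  have := h.1
  omega

theorem VertexType.IsII.not_isIII {τ : VertexType} (h : τ.IsII) : ¬ τ.IsIII := by
  rintro ⟨-, h', -⟩
  have := h.2.1
  omega

namespace OrientedCurve

variable {r s n : ℕ} {Δ : Fin n → ℤ × ℤ} {F : Finset (Fin n)}

theorem card_even_flags (C : OrientedCurve r s Δ F) (v : C.V) :
    ((C.flagsAt v).filter fun f => C.evenFlag f = true).card =
      (C.vertexType v).evenIn + (C.vertexType v).evenOut := by
  rw [← Finset.card_filter_add_card_filter_not (fun f => C.out f = false), Finset.filter_filter,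
    Finset.filter_filter]
  simp only [Bool.not_eq_false, vertexType, flagCount]

theorem card_odd_flags (C : OrientedCurve r s Δ F) (v : C.V) :
    ((C.flagsAt v).filter fun f => C.evenFlag f = false).card =
      (C.vertexType v).oddIn + (C.vertexType v).oddOut := by
  rw [← Finset.card_filter_add_card_filter_not (fun f => C.out f = false), Finset.filter_filter,
    Finset.filter_filter]
  simp only [Bool.not_eq_false, vertexType, flagCount]

theorem card_flagsAt (C : OrientedCurve r s Δ F) (v : C.V) :
    (C.flagsAt v).card = (C.vertexType v).evenIn + (C.vertexType v).evenOut +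
      ((C.vertexType v).oddIn + (C.vertexType v).oddOut) := by
  rw [← card_even_flags, ← card_odd_flags,
    ← Finset.card_filter_add_card_filter_not (fun f => C.evenFlag f = true)]
  simp only [Bool.not_eq_true]

/-- By balancing the two directions are opposite, so their weights agree. -/
theorem even_flags_of_card_two (C : OrientedCurve r s Δ F) (v : C.V)
    (h : (C.flagsAt v).card = 2) :
    (C.vertexType v).evenIn + (C.vertexType v).evenOut ≠ 1 := by
  rw [← card_even_flags]
  obtain ⟨f, g, hfg, hset⟩ := Finset.card_eq_two.1 h
  have hs := C.sum_dir_flagsAt v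
  rw [hset, Finset.sum_pair hfg] at hs
  have hp : Even (latticeWeight (C.dir f)) ↔ Even (latticeWeight (C.dir g)) := by
    rw [eq_neg_of_add_eq_zero_left hs, latticeWeight_neg]
  rw [hset, Finset.card_filter, Finset.sum_pair hfg]
  simp only [evenFlag, decide_eq_true_eq, hp]
  split_ifs <;> simp

/-- An edge is even iff its direction vanishes modulo 2. Three vectors of `𝔽₂²` with sum zero cannot
include exactly two zeros; if none is zero, any two are distinct and nonzero, hence independent, and
the determinant is odd. -/
theorem even_flags_of_card_three (C : OrientedCurve r s Δ F) (v : C.V)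
    (h : (C.flagsAt v).card = 3) :
    (C.vertexType v).evenIn + (C.vertexType v).evenOut ≠ 2 ∧
      (Even (C.mikhalkinMult v) ↔ (C.vertexType v).evenIn + (C.vertexType v).evenOut ≠ 0) := by
  rw [← card_even_flags]
  obtain ⟨f, g, k, hfg, hfk, hgk, hset⟩ := Finset.card_eq_three.1 h
  have hs := C.sum_dir_flagsAt v
  rw [C.mikhalkinMult_eq v h f g (by simp [hset]) (by simp [hset]) hfg]
  rw [hset, Finset.card_filter, Finset.sum_insert (by simp [hfg, hfk]), Finset.sum_pair hgk]
  rw [hset, Finset.sum_insert (by simp [hfg, hfk]), Finset.sum_pair hgk] at hs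
  have h1 : (C.dir k).1 = -((C.dir f).1 + (C.dir g).1) := by
    have := congrArg Prod.fst hs
    simp only [Prod.fst_add, Prod.fst_zero] at this
    linarith
  have h2 : (C.dir k).2 = -((C.dir f).2 + (C.dir g).2) := by
    have := congrArg Prod.snd hs
    simp only [Prod.snd_add, Prod.snd_zero] at this
    linarith
  simp only [evenFlag, decide_eq_true_eq, even_latticeWeight_iff, h1, h2, Int.natAbs_even,
    Int.even_sub, Int.even_mul, even_neg, Int.even_add]
  by_cases e1 : Even (C.dir f).1 <;> by_cases e2 : Even (C.dir f).2 <;>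
    by_cases e3 : Even (C.dir g).1 <;> by_cases e4 : Even (C.dir g).2 <;>
    simp [e1, e2, e3, e4]

/-! ### The broccoli index as a sum of local terms -/

/-- The contribution of a flag to the signed count of even edges at its vertex, outgoing ones counted
positively. -/
def evenOutflow (C : OrientedCurve r s Δ F) (f : C.Flag) : ℤ :=
  if C.evenFlag f then (if C.out f then 1 else -1) else 0

theorem sum_evenOutflow_flagsAt (C : OrientedCurve r s Δ F) (v : C.V) :
    ∑ f ∈ C.flagsAt v, C.evenOutflow f =
      ((C.vertexType v).evenOut : ℤ) - (C.vertexType v).evenIn := by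
  simp only [vertexType, flagCount, Finset.card_filter, Nat.cast_sum, ← Finset.sum_sub_distrib]
  refine Finset.sum_congr rfl fun f _ => ?_
  unfold evenOutflow
  cases C.evenFlag f <;> cases C.out f <;> simp

theorem evenOutflow_symm (C : OrientedCurve r s Δ F) (d : C.graph.Dart) :
    C.evenOutflow (.inl d.symm) = -C.evenOutflow (.inl d) := by
  simp only [evenOutflow, evenFlag, out, dir, C.dartDir_symm, latticeWeight_neg, C.forward_symm]
  by_cases h : C.forward d <;> by_cases hw : Even (latticeWeight (C.dartDir d)) <;>
    simp [h, hw]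

/-- The exponent of `y^{1/2} + y^{-1/2}` in the multiplicity of an end. -/
def endIndex (Δ : Fin n → ℤ × ℤ) (F : Finset (Fin n)) (i : Fin n) : ℤ :=
  if i ∈ F then (if Even (latticeWeight (Δ i)) then -1 else 0)
  else (if Even (latticeWeight (Δ i)) then 1 else 0)

open Classical in
/-- The exponent of `y^{1/2} + y^{-1/2}` in the multiplicity of a vertex. -/
noncomputable def vertexIndex (C : OrientedCurve r s Δ F) (v : C.V) : ℤ :=
  if (C.vertexType v).IsII then (if Even (C.mikhalkinMult v) then 1 else 0)
  else if (C.vertexType v).IsIII then (if Even (C.mikhalkinMult v) then -1 else 0) else 0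

/-- Reversing darts permutes the summands over bounded edges and changes their sign, so that part of
the sum is its own negative. -/
theorem sum_evenOutflow (C : OrientedCurve r s Δ F) :
    ∑ f, C.evenOutflow f = ∑ i, endIndex Δ F i := by
  rw [Fintype.sum_sum_type]
  have h : ∑ d : C.graph.Dart, C.evenOutflow (.inl d) = 0 := by
    have h1 : ∑ d : C.graph.Dart, C.evenOutflow (.inl d.symm) =
        ∑ d : C.graph.Dart, C.evenOutflow (.inl d) :=
      Equiv.sum_comp (SimpleGraph.Dart.symm_involutive (G := C.graph)).toPerm
        (fun d => C.evenOutflow (.inl d))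
    simp only [evenOutflow_symm, Finset.sum_neg_distrib] at h1
    linarith
  rw [h, zero_add]
  refine Finset.sum_congr rfl fun i _ => ?_
  simp only [evenOutflow, endIndex, evenFlag, out, dir]
  by_cases hi : i ∈ F <;> by_cases hw : Even (latticeWeight (Δ i)) <;> simp [hi, hw]

theorem broccoliIndex_eq_sum (C : OrientedCurve r s Δ F) :
    C.broccoliIndex = ∑ i, endIndex Δ F i + ∑ v, C.vertexIndex v := by
  classical
  have hE : ∑ i, endIndex Δ F i =
      - ((F.filter fun i => Even (latticeWeight (Δ i))).card : ℤ)
      + ((Fᶜ.filter fun i => Even (latticeWeight (Δ i))).card : ℤ) := by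
    rw [← Finset.sum_add_sum_compl F, Finset.card_filter, Finset.card_filter]
    push_cast
    rw [← Finset.sum_neg_distrib]
    congr 1
    · refine Finset.sum_congr rfl fun i hi => ?_
      simp only [endIndex, hi, if_true]
      split_ifs <;> simp
    · refine Finset.sum_congr rfl fun i hi => ?_
      simp only [endIndex, Finset.mem_compl.1 hi, if_false]
  have hV : ∑ v, C.vertexIndex v =
      - ((Finset.univ.filter fun v => (C.vertexType v).IsIII ∧ Even (C.mikhalkinMult v)).card : ℤ)
      + ((Finset.univ.filter fun v =>
          (C.vertexType v).IsII ∧ Even (C.mikhalkinMult v)).card : ℤ) := by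
    rw [Finset.card_filter, Finset.card_filter]
    push_cast
    rw [← Finset.sum_neg_distrib, ← Finset.sum_add_distrib]
    refine Finset.sum_congr rfl fun v _ => ?_
    unfold vertexIndex
    by_cases h2 : (C.vertexType v).IsII
    · simp [h2, h2.not_isIII]
    · by_cases h3 : (C.vertexType v).IsIII <;> simp [h2, h3]
      split_ifs <;> rfl
  rw [hE, hV, broccoliIndex]
  ring

open Classical in
theorem vertexIndex_add_evenOut_sub_evenIn (C : OrientedCurve r s Δ F) (v : C.V)
    (hv : (C.vertexType v).IsI ∨ (C.vertexType v).IsII ∨ (C.vertexType v).IsIII) :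
    C.vertexIndex v + (((C.vertexType v).evenOut : ℤ) - (C.vertexType v).evenIn) =
      if (C.vertexType v).IsOldBroccoli then 0 else 2 := by
  have hcard := C.card_flagsAt v
  have htwo := C.even_flags_of_card_two v
  have hthree := C.even_flags_of_card_three v
  unfold vertexIndex
  generalize C.vertexType v = τ at *
  generalize (C.flagsAt v).card = N at *
  obtain ⟨re, co, oi, oo, ei, eo⟩ := τ
  rcases hv with h | h | h
  · rw [if_neg h.not_isII, if_neg h.not_isIII]
    obtain ⟨rfl, rfl, h1, h2⟩ := h
    dsimp only at *
    have hN := htwo (by omega)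
    -- Only the case of two even edges contributes `2`.
    obtain ⟨rfl, rfl, ⟨rfl, rfl⟩ | ⟨rfl, rfl⟩⟩ :
        oi = 0 ∧ ei = 0 ∧ (oo = 2 ∧ eo = 0 ∨ oo = 0 ∧ eo = 2) := by omega
    all_goals simp [VertexType.IsOldBroccoli, VertexType.t1, VertexType.t2, VertexType.t3,
      VertexType.t4, VertexType.t5, VertexType.t6]
  · rw [if_pos h]
    obtain ⟨rfl, rfl, h1, h2⟩ := h
    dsimp only at *
    obtain ⟨hN, heven⟩ := hthree (by omega)
    rw [if_congr heven rfl rfl]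
    -- Only two odd edges flowing into an even one contribute `2`: the vertex index and the outgoing
    -- even edge give `1` each.
    obtain ⟨rfl, rfl, rfl, rfl⟩ | ⟨rfl, rfl, rfl, rfl⟩ | ⟨rfl, rfl, rfl, rfl⟩ |
        ⟨rfl, rfl, rfl, rfl⟩ :
        (oi = 2 ∧ oo = 1 ∧ ei = 0 ∧ eo = 0) ∨ (oi = 2 ∧ oo = 0 ∧ ei = 0 ∧ eo = 1) ∨
          (oi = 1 ∧ oo = 1 ∧ ei = 1 ∧ eo = 0) ∨ (oi = 0 ∧ oo = 0 ∧ ei = 2 ∧ eo = 1) := by omega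
    all_goals simp [VertexType.IsOldBroccoli, VertexType.t1, VertexType.t2, VertexType.t3,
      VertexType.t4, VertexType.t5, VertexType.t6]
  · rw [if_neg fun h2 => h2.not_isIII h, if_pos h]
    obtain ⟨rfl, rfl, h1, h2⟩ := h
    dsimp only at *
    obtain ⟨hN, heven⟩ := hthree (by omega)
    rw [if_congr heven rfl rfl]
    -- Only three even edges contribute `2`, as `-1 + 3`.
    obtain ⟨rfl, rfl, ⟨rfl, rfl⟩ | ⟨rfl, rfl⟩ | ⟨rfl, rfl⟩⟩ :
        oi = 0 ∧ ei = 0 ∧ (oo = 3 ∧ eo = 0 ∨ oo = 2 ∧ eo = 1 ∨ oo = 0 ∧ eo = 3) := by omega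
    all_goals simp [VertexType.IsOldBroccoli, VertexType.t1, VertexType.t2, VertexType.t3,
      VertexType.t4, VertexType.t5, VertexType.t6]

open Classical in
/-- The broccoli index is twice the number of vertices of the types forbidden in an old broccoli
curve. -/
theorem broccoliIndex_eq (C : OrientedCurve r s Δ F) (hC : C.IsRefinedBroccoli) :
    C.broccoliIndex = ((2 * (Finset.univ.filter fun v =>
      ¬ (C.vertexType v).IsOldBroccoli).card : ℕ) : ℤ) := by
  -- Double counting: the flags are grouped by their vertex.
  have h : ∑ f, C.evenOutflow f =
      ∑ v, (((C.vertexType v).evenOut : ℤ) - (C.vertexType v).evenIn) := by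
    rw [← Finset.sum_fiberwise Finset.univ C.base]
    exact Finset.sum_congr rfl fun v _ => C.sum_evenOutflow_flagsAt v
  rw [broccoliIndex_eq_sum, ← sum_evenOutflow, h, add_comm, ← Finset.sum_add_distrib,
    Finset.sum_congr rfl fun v _ => C.vertexIndex_add_evenOut_sub_evenIn v (hC v),
    mul_comm, Finset.card_filter, Finset.sum_mul]
  push_cast
  refine Finset.sum_congr rfl fun v _ => ?_
  split_ifs <;> simp_all

theorem hasSymmetricExpansion_vertexMult (C : OrientedCurve r s Δ F) (v : C.V) :
    HasSymmetricExpansion (C.vertexMult v) (C.vertexIndex v)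
      ((C.vertexType v).IsII → C.mikhalkinMult v ≠ 0) := by
  unfold vertexMult vertexIndex
  by_cases h2 : (C.vertexType v).IsII
  · rw [if_pos h2, if_pos h2]
    split_ifs with he
    · exact (HasSymmetricExpansion.even_sub he).mono fun h => h h2
    · exact (HasSymmetricExpansion.odd_sub he).mono fun _ => trivial
  · rw [if_neg h2, if_neg h2]
    split_ifs with h3 he
    · exact (HasSymmetricExpansion.even_add he).mono fun _ => trivial
    · exact (HasSymmetricExpansion.odd_add he).mono fun _ => trivial
    · exact HasSymmetricExpansion.one.mono fun _ => trivial

/-- The refined multiplicity, cleared of the weights of the non-fixed ends, is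
`(y^{1/2} + y^{-1/2})^{i_B}` times a symmetric integral Laurent polynomial. -/
theorem hasSymmetricExpansion_refinedMult (C : OrientedCurve r s Δ F) :
    HasSymmetricExpansion (C.refinedMult * ∏ i ∈ Fᶜ, (latticeWeight (Δ i) : RatFunc ℚ))
      C.broccoliIndex C.IsNondegenerate := by
  have hprod : C.refinedMult * ∏ i ∈ Fᶜ, (latticeWeight (Δ i) : RatFunc ℚ) =
      (∏ i, if i ∈ F then fixedEndMult (latticeWeight (Δ i))
        else nonFixedEndMult (latticeWeight (Δ i)) * (latticeWeight (Δ i) : RatFunc ℚ)) *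
      ∏ v, C.vertexMult v := by
    have hc : ∏ i ∈ Fᶜ, (latticeWeight (Δ i) : RatFunc ℚ) =
        ∏ i, if i ∈ F then 1 else (latticeWeight (Δ i) : RatFunc ℚ) := by
      rw [← Finset.prod_mul_prod_compl F, Finset.prod_congr rfl fun i hi => if_pos hi,
        Finset.prod_const_one, one_mul]
      exact Finset.prod_congr rfl fun i hi => (if_neg (Finset.mem_compl.1 hi)).symm
    rw [refinedMult, mul_right_comm, hc, ← Finset.prod_mul_distrib]
    congr 1
    refine Finset.prod_congr rfl fun i _ => ?_
    split_ifs <;> simp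
  rw [hprod, broccoliIndex_eq_sum]
  -- Ends need no condition for a nonzero value at `-1`, since their weights are nonzero; only
  -- vertices use nondegeneracy.
  refine ((HasSymmetricExpansion.prod (P := fun _ => True) Finset.univ fun i _ => ?_).mul
    (.prod Finset.univ fun v _ => C.hasSymmetricExpansion_vertexMult v)).mono
      fun h => ⟨fun _ _ => trivial, fun v _ => h v⟩
  unfold endIndex
  split_ifs with hi
  · simpa [*] using HasSymmetricExpansion.fixedEndMult (latticeWeight (Δ i))
  · simpa [*] using HasSymmetricExpansion.fixedEndMult (latticeWeight (Δ i))
  · simpa [*] using HasSymmetricExpansion.nonFixedEndMult (latticeWeight_ne_zero (C.end_ne_zero i))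
  · simpa [*] using HasSymmetricExpansion.nonFixedEndMult (latticeWeight_ne_zero (C.end_ne_zero i))

end OrientedCurve

/-! ### Assembling the three claims -/

/-- The Laurent polynomial `(y^{1/2} + y^{-1/2})^2 = y + 2 + y^{-1}`. -/
theorem exists_laurent_sq : ∃ q : ℤ[T;T⁻¹], laurentInY ℤ q = (sqrtY + sqrtY⁻¹) ^ 2 ∧
    LaurentPolynomial.invert q = q ∧ intAtNegOne q = 0 := by
  refine ⟨(.T ((1 : ℕ) : ℤ) + .T (-((1 : ℕ) : ℤ))) + 2, ?_, ?_, ?_⟩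
  · rw [map_add, laurentInY_T_add_T_neg, map_ofNat]
    generalize hz : sqrtY⁻¹ = z
    have h : sqrtY * z = 1 := hz ▸ mul_inv_cancel₀ sqrtY_ne_zero
    linear_combination -2 * h
  · rw [map_add, invert_T_add_T_neg, map_ofNat]
  · rw [map_add, intAtNegOne_T_add_T_neg, map_ofNat]
    norm_num

theorem lemma3p12 {r s n : ℕ} {Δ : Fin n → ℤ × ℤ} {F : Finset (Fin n)}
    (C : OrientedCurve r s Δ F) (hC : C.IsRefinedBroccoli) :
    (∃ p : ℤ[T;T⁻¹], laurentInY ℤ p =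
      C.refinedMult * ∏ i ∈ Fᶜ, (latticeWeight (Δ i) : RatFunc ℚ)) ∧
    (Fᶜ = ∅ → ∃ p : ℤ[T;T⁻¹], laurentInY ℤ p = C.refinedMult) ∧
    ∃ m : ℚ[T;T⁻¹], laurentInY ℚ m = C.refinedMult ∧
      LaurentPolynomial.invert m = m ∧
      (C.IsOldBroccoli → C.IsNondegenerate → atNegOne m ≠ 0) ∧
      (¬ C.IsOldBroccoli →
        atNegOne m = 0 ∧ Even C.broccoliIndex ∧ 0 < C.broccoliIndex ∧
        ∃ f : ℚ[T;T⁻¹],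
          C.refinedMult = (sqrtY + sqrtY⁻¹) ^ C.broccoliIndex * laurentInY ℚ f ∧
          (C.IsNondegenerate → atNegOne f ≠ 0)) := by
  classical
  obtain ⟨g, hg, hginv, hg0⟩ := C.hasSymmetricExpansion_refinedMult
  obtain ⟨q, hq, hqinv, hq0⟩ := exists_laurent_sq
  have hidx := C.broccoliIndex_eq hC
  set k := (Finset.univ.filter fun v => ¬ (C.vertexType v).IsOldBroccoli).card with hk
  have hqk : laurentInY ℤ (q ^ k) = (sqrtY + sqrtY⁻¹) ^ C.broccoliIndex := by
    rw [map_pow, hq, ← pow_mul, hidx, zpow_natCast]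
  have hint : laurentInY ℤ (q ^ k * g) =
      C.refinedMult * ∏ i ∈ Fᶜ, (latticeWeight (Δ i) : RatFunc ℚ) := by
    rw [map_mul, hqk, hg]
  -- Dividing by the weights of the non-fixed ends forces the passage from integral to rational
  -- coefficients.
  set W : ℚ := ∏ i ∈ Fᶜ, (latticeWeight (Δ i) : ℚ) with hW
  have hW0 : W ≠ 0 := Finset.prod_ne_zero_iff.2 fun i _ =>
    Nat.cast_ne_zero.2 (latticeWeight_ne_zero (C.end_ne_zero i))
  have hWmap : algebraMap ℚ (RatFunc ℚ) W = ∏ i ∈ Fᶜ, (latticeWeight (Δ i) : RatFunc ℚ) := by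
    rw [hW, map_prod]
    exact Finset.prod_congr rfl fun i _ => map_natCast _ _
  have hWmap0 : algebraMap ℚ (RatFunc ℚ) W ≠ 0 := (map_ne_zero _).2 hW0
  have hdiv : ∀ p : ℤ[T;T⁻¹], laurentInY ℚ (LaurentPolynomial.C W⁻¹ * laurentIntToRat p) =
      (algebraMap ℚ (RatFunc ℚ) W)⁻¹ * laurentInY ℤ p := fun p => by
    rw [map_mul, laurentInY_C, laurentInY_laurentIntToRat, map_inv₀]
  have hval : ∀ p : ℤ[T;T⁻¹], atNegOne (LaurentPolynomial.C W⁻¹ * laurentIntToRat p) =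
      W⁻¹ * intAtNegOne p := fun p => by
    rw [← atNegOne_laurentIntToRat]
    simp [atNegOne]
  refine ⟨⟨_, hint⟩, fun hF => ⟨q ^ k * g, by rw [hint, hF, Finset.prod_empty, mul_one]⟩,
    .C W⁻¹ * laurentIntToRat (q ^ k * g), ?_, ?_, fun hold hnd => ?_, fun hold => ?_⟩
  · rw [hdiv, hint, ← hWmap, mul_comm, mul_inv_cancel_right₀ hWmap0]
  · rw [map_mul, LaurentPolynomial.invert_C, invert_laurentIntToRat, map_mul, map_pow, hqinv,
      hginv]
  · have hk0 : k = 0 := by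
      rw [hk, Finset.card_eq_zero, Finset.filter_eq_empty_iff]
      exact fun v _ => not_not.2 (hold v)
    rw [hval, hk0, pow_zero, one_mul]
    exact mul_ne_zero (inv_ne_zero hW0) (hg0 hnd)
  · obtain ⟨v, hv⟩ := not_forall.1 hold
    have hkpos : 0 < k := Finset.card_pos.2 ⟨v, Finset.mem_filter.2 ⟨Finset.mem_univ v, hv⟩⟩
    -- The cofactor `f` is the same `g / W`, without the factor `q ^ k` that produces the zero at
    -- `-1`.
    refine ⟨?_, ?_, ?_, .C W⁻¹ * laurentIntToRat g, ?_, fun hnd => ?_⟩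
    · rw [hval, map_mul, map_pow, hq0, zero_pow hkpos.ne', zero_mul, mul_zero]
    · rw [hidx]
      exact ⟨k, by push_cast; ring⟩
    · rw [hidx]
      exact_mod_cast Nat.mul_pos two_pos hkpos
    · rw [hdiv, mul_left_comm, ← hg, ← hWmap, mul_comm, mul_inv_cancel_right₀ hWmap0]
    · rw [hval]
      exact mul_ne_zero (inv_ne_zero hW0) (hg0 hnd)
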